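/- Let $K,N_T,N_R\ge 1$ be integers and $\gamma_1,\dots,\gamma_K>0$. For $k=1,\dots,K$ let $\mathbf u_k\sim\mathcal{CN}(\mathbf 0,\mathbf I_{N_R})$ and $\mathbf v_k\sim\mathcal{CN}(\mathbf 0,\mathbf I_{N_T})$ be independent complex Gaussian random vectors, let $\mathbf H_k=\mathbf u_k\mathbf v_k^{\mathrm H}$ be the keyhole channel matrix of round $k$, and suppose that $\mathbf H_1,\dots,\mathbf H_K$ are independent. Put $$X_{CC}=\sum_{k=1}^K\frac{\gamma_k}{N_T}\|\mathbf u_k\|^2\|\mathbf v_k\|^2,\qquad \mathbf H_{CC}=\Big[\sqrt{\gamma_1/N_T}\,\mathbf H_1^{\mathrm H},\dots,\sqrt{\gamma_K/N_T}\,\mathbf H_K^{\mathrm H}\Big]^{\mathrm H},\qquad I_{CC}=\log_2\det\big(\mathbf I_{KN_R}+\mathbf H_{CC}\mathbf H_{CC}^{\mathrm H}\big),$$ $\tau=|N_T-N_R|$, and $m=N_T$ if $N_T\ge N_R$, $m=N_R$ if $N_T<N_R$. Let $$\Psi(\alpha,c;z)=\frac1{\Gamma(\alpha)}\int_0^\infty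 e^{-zt}t^{\alpha-1}(1+t)^{c-\alpha-1}\,dt\qquad(\operatorname{Re}\alpha>0,\ \operatorname{Re}z>0)$$ be the Tricomi confluent hypergeometric function. Then for every $a>0$ and every $x\in\mathbb R$ the cumulative distribution function of $X_{CC}$ is $$F_{X_{CC}}(x)=\prod_{k=1}^K\Big(\frac{N_T}{\gamma_k}\Big)^{m}\;\frac1{2\pi\mathrm i}\int_{a-\mathrm i\infty}^{a+\mathrm i\infty}\frac{\prod_{k=1}^K\Psi\big(m,\tau+1;\frac{N_T}{\gamma_k}s^{-1}\big)}{s^{Km+1}}\,e^{sx}\,ds,$$ where the integral converges absolutely. Consequently, for every rate $R\in\mathbb R$, the outage probability $P_{out}^{CC}=\Pr(I_{CC}<R)$ of HARQ with chase combining satisfies $P_{out}^{CC}\le F_{X_{CC}}(2^R-1)$, so it is bounded above by the right-hand side at $x=2^R-1$. -/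

import Mathlib

open MeasureTheory ProbabilityTheory

noncomputable section

/-- The circularly symmetric complex normal law `CN(0, 1)` on `ℂ`: independent real and imaginary
parts, each a centred real Gaussian of variance `1 / 2`. -/
def complexStdNormal : Measure ℂ :=
  ((gaussianReal 0 (1 / 2)).prod (gaussianReal 0 (1 / 2))).map
    (fun p : ℝ × ℝ => (p.1 : ℂ) + (p.2 : ℂ) * Complex.I)

/-- The complex normal law `CN(0, I_n)` on `ℂⁿ`: the `n` entries are i.i.d. `CN(0, 1)`. -/
def complexStdNormalVec (n : ℕ) : Measure (EuclideanSpace ℂ (Fin n)) :=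
  (Measure.pi (fun _ : Fin n => complexStdNormal)).map (WithLp.toLp 2)

/-- The keyhole channel matrix `u vᴴ`, of size `N_R × N_T`. -/
def keyholeMatrix {NT NR : ℕ} (u : EuclideanSpace ℂ (Fin NR)) (v : EuclideanSpace ℂ (Fin NT)) :
    Matrix (Fin NR) (Fin NT) ℂ :=
  Matrix.of fun i j => u i * star (v j)

/-- The chase-combining matrix `H_CC = [√(γ₁/N_T) H₁ᴴ, …, √(γ_K/N_T) H_Kᴴ]ᴴ`, that is, the
`K N_R × N_T` matrix obtained by stacking the blocks `√(γ_k/N_T) H_k`. -/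
def chaseMatrix {K NT NR : ℕ} (γ : Fin K → ℝ) (H : Fin K → Matrix (Fin NR) (Fin NT) ℂ) :
    Matrix (Fin K × Fin NR) (Fin NT) ℂ :=
  Matrix.of fun p j => ((Real.sqrt (γ p.1 / NT) : ℝ) : ℂ) * H p.1 p.2 j

/-- The accumulated mutual information of HARQ with chase combining,
`I_CC = log₂ det (I + H_CC H_CCᴴ)`. (The determinant is that of a positive definite Hermitian
matrix, hence a positive real number; the real part only changes its type.) -/
def mutualInfoCC {K NT NR : ℕ} (γ : Fin K → ℝ) (H : Fin K → Matrix (Fin NR) (Fin NT) ℂ) : ℝ :=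
  Real.logb 2 ((1 + chaseMatrix γ H * (chaseMatrix γ H).conjTranspose).det).re

/-- `X_CC = ∑ₖ (γₖ / N_T) ‖uₖ‖² ‖vₖ‖²`. -/
def chaseGain {K NT NR : ℕ} (γ : Fin K → ℝ) (u : Fin K → EuclideanSpace ℂ (Fin NR))
    (v : Fin K → EuclideanSpace ℂ (Fin NT)) : ℝ :=
  ∑ k, γ k / NT * (‖u k‖ ^ 2 * ‖v k‖ ^ 2)

/-- The Tricomi confluent hypergeometric function
`Ψ(α, c; z) = Γ(α)⁻¹ ∫₀^∞ e^{-zt} t^{α-1} (1+t)^{c-α-1} dt`, for `Re α > 0` and `Re z > 0`. -/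
def tricomiPsi (α c z : ℂ) : ℂ :=
  (Complex.Gamma α)⁻¹ *
    ∫ t in Set.Ioi (0 : ℝ),
      Complex.exp (-z * t) * (t : ℂ) ^ (α - 1) * (1 + (t : ℂ)) ^ (c - α - 1)

/-- The Bromwich integrand
`∏ₖ Ψ(m, τ + 1; (N_T / γₖ) s⁻¹) / s^{K m + 1} · e^{s x}`, where `τ = |N_T - N_R|`. -/
def bromwichIntegrand {K : ℕ} (NT NR m : ℕ) (γ : Fin K → ℝ) (x : ℝ) (s : ℂ) : ℂ :=
  (∏ k, tricomiPsi (m : ℂ) (((|(NT : ℝ) - (NR : ℝ)| + 1 : ℝ) : ℂ))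
      (((NT / γ k : ℝ) : ℂ) * s⁻¹)) / s ^ (K * m + 1) * Complex.exp (s * x)

/-- The contour integral `∫_{a - i∞}^{a + i∞} f(s) ds` along the upward vertical line `Re s = a`. -/
def verticalLineIntegral (f : ℂ → ℂ) (a : ℝ) : ℂ :=
  ∫ y : ℝ, f (a + y * Complex.I) * Complex.I

/-- `∏ₖ (N_T / γₖ)^m · (2πi)⁻¹ ∫_{a - i∞}^{a + i∞} ∏ₖ Ψ(m, τ+1; (N_T/γₖ) s⁻¹) / s^{Km+1} e^{sx} ds`. -/
def bromwichCDF {K : ℕ} (NT NR m : ℕ) (γ : Fin K → ℝ) (a x : ℝ) : ℂ :=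
  (∏ k, (((NT / γ k) ^ m : ℝ) : ℂ)) *
    (1 / (2 * (Real.pi : ℂ) * Complex.I) *
      verticalLineIntegral (bromwichIntegrand NT NR m γ x) a)

end

/-!
The squared norms `Uₖ = ‖uₖ‖²` and `Vₖ = ‖vₖ‖²` have unit-rate Gamma laws; only their Laplace
transforms `(1 + z)⁻ⁿ` on the closed right half-plane enter (`hasGammaLaplace_norm_sq`). Averaging
`e^{-wUV}` over `V` and then over `U` gives `Γ(n)⁻¹ ∫ y^{n-1} e^{-y} (1 + wy)^{-m} dy`, and writing
the negative power as a Gamma integral with complex rate turns this into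
`w^{-m} Ψ(m, m - n + 1; w⁻¹)` for every `w` with `Re w > 0`
(`integral_cexp_neg_mul_mul`, `integral_gamma_inv_pow_eq_tricomiPsi`). Since `Uₖ Vₖ` is the squared
Frobenius norm of `Hₖ`, these products are independent, and the Laplace transform of `X_CC` is the
product of the factors with `w = s γₖ / N_T`. The two cases of the theorem exchange the roles of
`U` and `V`.

The Laplace transform of the distribution function is that of `X_CC` divided by `s`. A single
factor is already `O(‖s‖^{-1/2})`, so the quotient is `O(‖s‖^{-3/2})` on a vertical line, hence
absolutely integrable (`integrable_laplace_div`). Fourier inversion recovers the distribution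
function at its continuity points, and right-continuity does the rest (`cdf_eq_bromwich`), so that
absence of atoms need not be shown.

For the outage probability, `H_CC H_CCᴴ` is positive semidefinite with trace `X_CC`, and
`det (1 + A) ≥ 1 + tr A`, so `I_CC < R` forces `X_CC < 2 ^ R - 1`.
-/

/-! ### Gamma integrals with a complex rate -/

lemma integrableOn_pow_mul_cexp_neg_mul (n : ℕ) {r : ℂ} (hr : 0 < r.re) :
    IntegrableOn (fun t : ℝ => (t : ℂ) ^ n * Complex.exp (-r * t)) (Set.Ioi 0) := by
  have h := integrableOn_rpow_mul_exp_neg_mul_rpow (p := 1) (s := n) (b := r.re)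
    (by have : (0 : ℝ) ≤ n := n.cast_nonneg
        linarith) one_pos hr
  refine Integrable.mono' h (by fun_prop) ?_
  filter_upwards [ae_restrict_mem measurableSet_Ioi] with t ht
  rw [norm_mul, norm_pow, Complex.norm_real, Real.norm_of_nonneg (le_of_lt ht), Complex.norm_exp]
  simp

lemma integral_pow_mul_cexp_neg_mul (n : ℕ) {r : ℂ} (hr : 0 < r.re) :
    ∫ t in Set.Ioi (0 : ℝ), (t : ℂ) ^ n * Complex.exp (-r * t) = n.factorial / r ^ (n + 1) := by
  have hr0 : r ≠ 0 := by rintro rfl; simp at hr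
  induction n with
  | zero =>
    have := integral_exp_mul_complex_Ioi (a := -r) (by simpa using hr) 0
    simp only [pow_zero, one_mul, this]
    simp [neg_div_neg_eq]
  | succ n ih =>
    have hv (x : ℝ) :
        HasDerivAt (fun t : ℝ => -Complex.exp (-r * t) / r) (Complex.exp (-r * x)) x := by
      have h1 : HasDerivAt (fun t : ℝ => -r * (t : ℂ)) (-r * 1) x :=
        (Complex.ofRealCLM.hasDerivAt (x := x)).const_mul (-r)
      convert! (h1.cexp.neg.div_const r) using 1
      field_simp
    have hu (x : ℝ) :
        HasDerivAt (fun t : ℝ => (t : ℂ) ^ (n + 1)) ((n + 1 : ℕ) * (x : ℂ) ^ n) x := by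
      have h1 : HasDerivAt (fun t : ℝ => (t : ℂ)) 1 x := Complex.ofRealCLM.hasDerivAt
      convert! h1.pow (n + 1) using 1
      simp
    have hlim : Filter.Tendsto (fun t : ℝ => (t : ℂ) ^ (n + 1) * (-Complex.exp (-r * t) / r))
        Filter.atTop (nhds 0) := by
      rw [tendsto_zero_iff_norm_tendsto_zero]
      have h2 := ((Real.tendsto_pow_mul_exp_neg_atTop_nhds_zero (n + 1)).comp
        (Filter.tendsto_id.const_mul_atTop hr)).mul_const ((r.re ^ (n + 1))⁻¹ * ‖r‖⁻¹)
      rw [zero_mul] at h2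
      refine h2.congr' ?_
      filter_upwards [Filter.eventually_ge_atTop 0] with t ht
      simp only [Function.comp_apply, id, norm_mul, norm_pow, norm_div, norm_neg, Complex.norm_exp,
        Complex.norm_real, Real.norm_of_nonneg ht]
      simp only [Complex.mul_re, Complex.neg_re, Complex.ofReal_re, Complex.ofReal_im, mul_zero,
        sub_zero, neg_mul, mul_pow]
      have : r.re ^ (n + 1) ≠ 0 := (pow_pos hr _).ne'
      field_simp
    have key := integral_Ioi_mul_deriv_eq_deriv_mul (a := (0 : ℝ)) (fun x _ => hu x)
      (fun x _ => hv x) (integrableOn_pow_mul_cexp_neg_mul (n + 1) hr)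
      (by
        have := (integrableOn_pow_mul_cexp_neg_mul n hr).const_mul (-((n + 1 : ℕ) : ℂ) / r)
        refine this.congr (Filter.Eventually.of_forall fun t => ?_)
        simp only [Pi.mul_apply]
        ring)
      (a' := 0) (b' := 0)
      (by
        have hc : Continuous fun t : ℝ => (t : ℂ) ^ (n + 1) * (-Complex.exp (-r * t) / r) := by
          fun_prop
        have := (hc.tendsto 0).mono_left (nhdsWithin_le_nhds (s := Set.Ioi 0))
        convert! this using 2
        simp)
      hlim
    rw [key]
    have h3 : (fun t : ℝ => ((n + 1 : ℕ) : ℂ) * (t : ℂ) ^ n * (-Complex.exp (-r * t) / r)) =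
        fun t : ℝ => (-((n + 1 : ℕ) : ℂ) / r) * ((t : ℂ) ^ n * Complex.exp (-r * t)) := by
      funext t; ring
    rw [h3, integral_const_mul, ih, Nat.factorial_succ]
    push_cast
    field_simp
    ring

/-! ### Expectations of `exp (-w U V)` and the Tricomi function -/

lemma one_le_norm_one_add {z : ℂ} (hz : 0 ≤ z.re) : 1 ≤ ‖1 + z‖ := by
  have := Complex.re_le_norm (1 + z)
  simp at this
  linarith

lemma norm_le_norm_one_add {z : ℂ} (hz : 0 ≤ z.re) : ‖z‖ ≤ ‖1 + z‖ := by
  rw [← sq_le_sq₀ (norm_nonneg _) (norm_nonneg _), ← Complex.normSq_eq_norm_sq,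
    ← Complex.normSq_eq_norm_sq, Complex.normSq_apply, Complex.normSq_apply]
  simp
  nlinarith

lemma one_add_ne_zero_of_re_nonneg {z : ℂ} (hz : 0 ≤ z.re) : 1 + z ≠ 0 :=
  norm_pos_iff.mp (one_pos.trans_le (one_le_norm_one_add hz))

/-- The integrand of the Tricomi function with natural first parameter `b + 1`
and second parameter `b + 1 - a` has natural exponents. -/
lemma tricomiPsi_natCast (a b : ℕ) (z : ℂ) :
    tricomiPsi (b + 1 : ℕ) ((b + 1 : ℕ) - (a + 1 : ℕ) + 1) z =
      (b.factorial : ℂ)⁻¹ * ∫ t in Set.Ioi (0 : ℝ),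
        (t : ℂ) ^ b * Complex.exp (-z * t) * ((1 + (t : ℂ)) ^ (a + 1))⁻¹ := by
  unfold tricomiPsi
  rw [show ((b + 1 : ℕ) : ℂ) = (b : ℂ) + 1 by push_cast; rfl, Complex.Gamma_nat_eq_factorial]
  congr 1
  refine setIntegral_congr_fun measurableSet_Ioi fun t _ => ?_
  have h1 : (b : ℂ) + 1 - 1 = (b : ℕ) := by ring
  have h2 : (b : ℂ) + 1 - ((a + 1 : ℕ) : ℂ) + 1 - (b + 1) - 1 = -((a + 1 : ℕ) : ℂ) := by ring
  simp only [h1, h2, Complex.cpow_neg, Complex.cpow_natCast]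
  ring

/-- Both sides are iterated integrals of `tᵇ e^{-t/w} yᵃ e^{-y} e^{-ty}`, up to factorials. -/
lemma integral_gamma_inv_pow_eq_tricomiPsi (a b : ℕ) {w : ℂ} (hw : 0 < w.re) :
    (a.factorial : ℂ)⁻¹ * ∫ y in Set.Ioi (0 : ℝ),
        (y : ℂ) ^ a * Complex.exp (-y) * ((1 + w * y) ^ (b + 1))⁻¹ =
      (w ^ (b + 1))⁻¹ * tricomiPsi (b + 1 : ℕ) ((b + 1 : ℕ) - (a + 1 : ℕ) + 1) w⁻¹ := by
  have hw0 : w ≠ 0 := by rintro rfl; simp at hw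
  have hwi : 0 < (w⁻¹).re := by
    rw [Complex.inv_re]
    exact div_pos hw (Complex.normSq_pos.mpr hw0)
  have hfa : (a.factorial : ℂ) ≠ 0 := Nat.cast_ne_zero.mpr a.factorial_ne_zero
  have hfb : (b.factorial : ℂ) ≠ 0 := Nat.cast_ne_zero.mpr b.factorial_ne_zero
  set F : ℝ → ℝ → ℂ := fun y t =>
    (y : ℂ) ^ a * Complex.exp (-1 * y) * ((t : ℂ) ^ b * Complex.exp (-w⁻¹ * t)) *
      Complex.exp (-(t * y)) with hF
  have hint : Integrable (Function.uncurry F)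
      ((volume.restrict (Set.Ioi (0 : ℝ))).prod (volume.restrict (Set.Ioi (0 : ℝ)))) := by
    have h := (integrableOn_pow_mul_cexp_neg_mul a (r := 1) (by simp)).mul_prod
      (integrableOn_pow_mul_cexp_neg_mul b hwi)
    refine h.mono (by fun_prop) ?_
    rw [Measure.prod_restrict]
    filter_upwards [ae_restrict_mem (measurableSet_Ioi.prod measurableSet_Ioi)] with p hp
    rw [Function.uncurry, hF, norm_mul]
    refine mul_le_of_le_one_right (norm_nonneg _) ?_
    rw [Complex.norm_exp, Real.exp_le_one_iff]
    have : 0 ≤ p.2 * p.1 := mul_nonneg (le_of_lt hp.2) (le_of_lt hp.1)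
    simpa using this
  have hswap := integral_integral_swap hint
  have hL : ∀ y ∈ Set.Ioi (0 : ℝ), ∫ t in Set.Ioi (0 : ℝ), F y t =
      (b.factorial * w ^ (b + 1)) *
        ((y : ℂ) ^ a * Complex.exp (-y) * ((1 + w * y) ^ (b + 1))⁻¹) := by
    intro y hy
    have hre : 0 < (w⁻¹ + y).re := by
      simp only [Complex.add_re, Complex.ofReal_re]
      exact add_pos hwi hy
    have e : F y = fun t : ℝ => ((y : ℂ) ^ a * Complex.exp (-y)) *
        ((t : ℂ) ^ b * Complex.exp (-(w⁻¹ + y) * t)) := by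
      funext t
      rw [hF, show -(w⁻¹ + (y : ℂ)) * t = -w⁻¹ * t + -(t * y) by ring, Complex.exp_add]
      simp only [neg_mul, one_mul]
      ring
    rw [e, integral_const_mul, integral_pow_mul_cexp_neg_mul b hre]
    have : w⁻¹ + (y : ℂ) = w⁻¹ * (1 + w * y) := by field_simp
    rw [this, mul_pow, inv_pow, div_eq_mul_inv, mul_inv, inv_inv]
    ring
  have hR : ∀ t ∈ Set.Ioi (0 : ℝ), ∫ y in Set.Ioi (0 : ℝ), F y t =
      a.factorial * ((t : ℂ) ^ b * Complex.exp (-w⁻¹ * t) * ((1 + (t : ℂ)) ^ (a + 1))⁻¹) := by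
    intro t ht
    have hre : 0 < (1 + (t : ℂ)).re := by
      simp only [Complex.add_re, Complex.ofReal_re, Complex.one_re]
      exact add_pos one_pos ht
    have e : (fun y => F y t) = fun y : ℝ => ((t : ℂ) ^ b * Complex.exp (-w⁻¹ * t)) *
        ((y : ℂ) ^ a * Complex.exp (-(1 + (t : ℂ)) * y)) := by
      funext y
      rw [hF, show -(1 + (t : ℂ)) * y = -1 * y + -(t * y) by ring, Complex.exp_add]
      ring
    rw [e, integral_const_mul, integral_pow_mul_cexp_neg_mul a hre, div_eq_mul_inv]
    ring
  rw [setIntegral_congr_fun measurableSet_Ioi hL, setIntegral_congr_fun measurableSet_Ioi hR,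
    integral_const_mul, integral_const_mul] at hswap
  rw [tricomiPsi_natCast]
  have hwp : w ^ (b + 1) ≠ 0 := pow_ne_zero _ hw0
  generalize (∫ y in Set.Ioi (0 : ℝ),
    (y : ℂ) ^ a * Complex.exp (-y) * ((1 + w * y) ^ (b + 1))⁻¹) = A at hswap ⊢
  generalize (∫ t in Set.Ioi (0 : ℝ),
    (t : ℂ) ^ b * Complex.exp (-w⁻¹ * t) * ((1 + (t : ℂ)) ^ (a + 1))⁻¹) = B at hswap ⊢
  field_simp
  linear_combination hswap

/-- The Laplace transform of a unit-rate Gamma law of shape `n`, as a property of a random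
variable: on the closed right half-plane `E e^{-zU} = (1 + z)⁻ⁿ`. -/
def HasGammaLaplace {Ω : Type*} [MeasurableSpace Ω] (P : Measure Ω) (U : Ω → ℝ) (n : ℕ) : Prop :=
  ∀ z : ℂ, 0 ≤ z.re → ∫ ω, Complex.exp (-z * U ω) ∂P = ((1 + z) ^ n)⁻¹

section Product

variable {Ω : Type*} [MeasurableSpace Ω] {P : Measure Ω} [IsProbabilityMeasure P]
  {U V : Ω → ℝ}

/-- Averaging over `V` first, then writing `(1 + wU)⁻ᵃ⁻¹` as a Gamma integral and averaging
over `U`. -/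
lemma integral_cexp_neg_mul_mul {a b : ℕ} (hU : AEMeasurable U P) (hV : AEMeasurable V P)
    (hU0 : ∀ ω, 0 ≤ U ω) (hV0 : ∀ ω, 0 ≤ V ω) (hind : IndepFun U V P)
    (hUL : HasGammaLaplace P U (b + 1)) (hVL : HasGammaLaplace P V (a + 1))
    {w : ℂ} (hw : 0 < w.re) :
    ∫ ω, Complex.exp (-w * (U ω * V ω)) ∂P =
      (a.factorial : ℂ)⁻¹ * ∫ y in Set.Ioi (0 : ℝ),
        (y : ℂ) ^ a * Complex.exp (-y) * ((1 + w * y) ^ (b + 1))⁻¹ := by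
  have := Measure.isProbabilityMeasure_map (μ := P) hU
  have := Measure.isProbabilityMeasure_map (μ := P) hV
  have hfa : (a.factorial : ℂ) ≠ 0 := Nat.cast_ne_zero.mpr a.factorial_ne_zero
  have hjoint := (indepFun_iff_map_prod_eq_prod_map_map hU hV).mp hind
  have hUpos : ∀ᵐ x ∂P.map U, 0 ≤ x :=
    (ae_map_iff hU measurableSet_Ici).mpr (Filter.Eventually.of_forall hU0)
  set F : ℝ → ℝ → ℂ := fun x y =>
    (y : ℂ) ^ a * Complex.exp (-1 * y) * Complex.exp (-(w * y) * x) with hF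
  have hint : Integrable (Function.uncurry F)
      ((P.map U).prod (volume.restrict (Set.Ioi (0 : ℝ)))) := by
    have h := (integrable_const (μ := P.map U) (1 : ℂ)).mul_prod
      (integrableOn_pow_mul_cexp_neg_mul a (r := 1) (by simp))
    refine h.mono (by fun_prop) ?_
    have h1 := Measure.ae_prod_iff_ae_ae (μ := P.map U)
      (ν := volume.restrict (Set.Ioi (0 : ℝ))) (p := fun p => 0 ≤ p.1 ∧ 0 < p.2)
      ((measurableSet_Ici.preimage measurable_fst).inter
        (measurableSet_Ioi.preimage measurable_snd))
    have h2 : ∀ᵐ p ∂(P.map U).prod (volume.restrict (Set.Ioi (0 : ℝ))), 0 ≤ p.1 ∧ 0 < p.2 := by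
      refine h1.mpr ?_
      filter_upwards [hUpos] with x hx
      filter_upwards [ae_restrict_mem measurableSet_Ioi] with y hy
      exact ⟨hx, hy⟩
    filter_upwards [h2] with p hp
    rw [Function.uncurry, hF, norm_mul, one_mul]
    refine mul_le_of_le_one_right (norm_nonneg _) ?_
    rw [Complex.norm_exp, Real.exp_le_one_iff]
    have : 0 ≤ w.re * p.2 * p.1 := mul_nonneg (mul_nonneg hw.le hp.2.le) hp.1
    simpa using this
  have hswap := integral_integral_swap hint
  have hre {x : ℝ} (hx : 0 ≤ x) : 0 ≤ (w * x).re := by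
    simpa using mul_nonneg hw.le hx
  have hL : ∀ᵐ x ∂P.map U, ∫ y in Set.Ioi (0 : ℝ), F x y =
      a.factorial * ∫ v, Complex.exp (-w * (x * v)) ∂P.map V := by
    filter_upwards [hUpos] with x hx
    have e : F x = fun y : ℝ => (y : ℂ) ^ a * Complex.exp (-(1 + w * x) * y) := by
      funext y
      rw [hF, show -(1 + w * (x : ℂ)) * y = -1 * y + -(w * y) * x by ring, Complex.exp_add]
      ring
    have h1 : 0 < (1 + w * (x : ℂ)).re := by
      rw [Complex.add_re, Complex.one_re]
      linarith [hre hx]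
    have e2 : (fun v : ℝ => Complex.exp (-w * (x * v))) =
        fun v : ℝ => Complex.exp (-(w * x) * v) := by
      funext v
      congr 1
      ring
    rw [e, integral_pow_mul_cexp_neg_mul a h1, e2,
      integral_map hV (by fun_prop : AEStronglyMeasurable _ _), hVL _ (hre hx), div_eq_mul_inv]
  have hR : ∀ y ∈ Set.Ioi (0 : ℝ), ∫ x, F x y ∂P.map U =
      (y : ℂ) ^ a * Complex.exp (-y) * ((1 + w * y) ^ (b + 1))⁻¹ := by
    intro y hy
    simp only [hF]
    rw [integral_const_mul, integral_map hU (by fun_prop : AEStronglyMeasurable _ _),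
      hUL _ (hre (le_of_lt hy)), neg_one_mul]
  rw [setIntegral_congr_fun measurableSet_Ioi hR, integral_congr_ae hL, integral_const_mul]
    at hswap
  have hmain : ∫ ω, Complex.exp (-w * (U ω * V ω)) ∂P =
      ∫ x, ∫ v, Complex.exp (-w * (x * v)) ∂P.map V ∂P.map U := by
    rw [← integral_prod (fun p : ℝ × ℝ => Complex.exp (-w * (p.1 * p.2))), ← hjoint,
      integral_map (hU.prodMk hV) (by fun_prop : AEStronglyMeasurable _ _)]
    have h2 : ∀ᵐ p ∂(P.map U).prod (P.map V), ‖Complex.exp (-w * (p.1 * p.2))‖ ≤ 1 := by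
      rw [← hjoint]
      refine (ae_map_iff (hU.prodMk hV) (measurableSet_le (by fun_prop) (by fun_prop))).mpr
        (Filter.Eventually.of_forall fun ω => ?_)
      rw [Complex.norm_exp, Real.exp_le_one_iff]
      have : 0 ≤ w.re * (U ω * V ω) := mul_nonneg hw.le (mul_nonneg (hU0 ω) (hV0 ω))
      simpa [← Complex.ofReal_mul] using this
    exact Integrable.mono' (integrable_const (1 : ℝ)) (by fun_prop) h2
  rw [hmain, ← hswap, inv_mul_cancel_left₀ hfa]

/-- A uniform bound `‖1 + wy‖⁻ⁿ ≤ ‖wy‖^{-1/2}` makes the Laplace transform of `UV` decay like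
`‖w‖^{-1/2}`. -/
lemma exists_norm_integral_cexp_neg_mul_mul_le {a b : ℕ} (hU : AEMeasurable U P)
    (hV : AEMeasurable V P) (hU0 : ∀ ω, 0 ≤ U ω) (hV0 : ∀ ω, 0 ≤ V ω) (hind : IndepFun U V P)
    (hUL : HasGammaLaplace P U (b + 1)) (hVL : HasGammaLaplace P V (a + 1)) :
    ∃ C : ℝ, ∀ w : ℂ, 0 < w.re →
      ‖∫ ω, Complex.exp (-w * (U ω * V ω)) ∂P‖ ≤ C * (√‖w‖)⁻¹ := by
  refine ⟨(a.factorial : ℝ)⁻¹ *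
    ∫ y in Set.Ioi (0 : ℝ), y ^ ((a : ℝ) - 1 / 2) * Real.exp (-1 * y ^ (1 : ℝ)), fun w hw => ?_⟩
  have hw0 : 0 < ‖w‖ := norm_pos_iff.mpr (by rintro rfl; simp at hw)
  rw [integral_cexp_neg_mul_mul hU hV hU0 hV0 hind hUL hVL hw, norm_mul, norm_inv,
    Complex.norm_natCast, mul_assoc]
  refine mul_le_mul_of_nonneg_left ?_ (by positivity)
  rw [← integral_mul_const]
  have hI := integrableOn_rpow_mul_exp_neg_mul_rpow (p := 1) (s := (a : ℝ) - 1 / 2) (b := 1)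
    (by have : (0 : ℝ) ≤ a := a.cast_nonneg
        linarith) one_pos one_pos
  refine norm_integral_le_of_norm_le (hI.mul_const _) ?_
  filter_upwards [ae_restrict_mem measurableSet_Ioi] with y hy
  have hy : 0 < y := hy
  have hre : 0 ≤ (w * y).re := by
    simpa using mul_nonneg hw.le hy.le
  have h1 : √(‖w‖ * y) ≤ ‖1 + w * y‖ ^ (b + 1) := by
    calc √(‖w‖ * y) ≤ ‖1 + w * y‖ := by
          rw [Real.sqrt_le_left (norm_nonneg _)]
          have h2 := norm_le_norm_one_add hre
          rw [norm_mul, Complex.norm_real, Real.norm_of_nonneg hy.le] at h2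
          nlinarith [one_le_norm_one_add hre]
      _ ≤ ‖1 + w * y‖ ^ (b + 1) := le_self_pow₀ (one_le_norm_one_add hre) (by simp)
  have h3 : y ^ ((a : ℝ) - 1 / 2) = y ^ a * (√y)⁻¹ := by
    rw [Real.rpow_sub hy, Real.rpow_natCast, Real.sqrt_eq_rpow, div_eq_mul_inv]
  rw [norm_mul, norm_mul, norm_pow, norm_inv, norm_pow, Complex.norm_real,
    Real.norm_of_nonneg hy.le, Complex.norm_exp, h3, Real.rpow_one]
  have h4 : (‖1 + w * y‖ ^ (b + 1))⁻¹ ≤ (√‖w‖)⁻¹ * (√y)⁻¹ := by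
    rw [← mul_inv, ← Real.sqrt_mul (norm_nonneg _)]
    exact inv_anti₀ (Real.sqrt_pos.mpr (mul_pos hw0 hy)) h1
  calc _ = y ^ a * Real.exp (-1 * y) * (‖1 + w * y‖ ^ (b + 1))⁻¹ := by simp
    _ ≤ y ^ a * Real.exp (-1 * y) * ((√‖w‖)⁻¹ * (√y)⁻¹) := by gcongr
    _ = _ := by ring

end Product

/-! ### Gaussian vectors -/

instance isProbabilityMeasure_complexStdNormal : IsProbabilityMeasure complexStdNormal :=
  Measure.isProbabilityMeasure_map (by fun_prop)

lemma integral_cexp_neg_mul_sq_gaussianReal {z : ℂ} (hz : 0 ≤ z.re) :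
    ∫ x, Complex.exp (-z * (x : ℂ) ^ 2) ∂gaussianReal 0 (1 / 2) =
      (√Real.pi : ℂ)⁻¹ * (Real.pi / (1 + z)) ^ (1 / 2 : ℂ) := by
  have hre : 0 < (1 + z).re := by
    rw [Complex.add_re, Complex.one_re]
    linarith
  rw [integral_gaussianReal_eq_integral_smul (by simp), ← integral_gaussian_complex hre,
    ← integral_const_mul]
  refine integral_congr_ae (Filter.Eventually.of_forall fun x => ?_)
  simp only [gaussianPDFReal_def, Complex.real_smul]
  rw [show -(1 + z) * (x : ℂ) ^ 2 = -(x : ℂ) ^ 2 + -z * (x : ℂ) ^ 2 by ring, Complex.exp_add]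
  have h2 : (√2 : ℂ) ≠ 0 := by simp
  push_cast
  simp
  field_simp

lemma integral_cexp_neg_mul_norm_sq_complexStdNormal {z : ℂ} (hz : 0 ≤ z.re) :
    ∫ c, Complex.exp (-z * (‖c‖ : ℂ) ^ 2) ∂complexStdNormal = (1 + z)⁻¹ := by
  have h0 := one_add_ne_zero_of_re_nonneg hz
  have e (p : ℝ × ℝ) : Complex.exp (-z * (‖(p.1 : ℂ) + (p.2 : ℂ) * Complex.I‖ : ℂ) ^ 2) =
      Complex.exp (-z * (p.1 : ℂ) ^ 2) * Complex.exp (-z * (p.2 : ℂ) ^ 2) := by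
    rw [← Complex.exp_add, ← Complex.ofReal_pow, Complex.sq_norm, Complex.normSq_add_mul_I]
    push_cast
    ring_nf
  rw [complexStdNormal, integral_map (by fun_prop) (by fun_prop)]
  simp only [e]
  rw [integral_prod_mul (fun x : ℝ => Complex.exp (-z * (x : ℂ) ^ 2))
      (fun x : ℝ => Complex.exp (-z * (x : ℂ) ^ 2)), integral_cexp_neg_mul_sq_gaussianReal hz, mul_mul_mul_comm, ← mul_inv,
    ← sq, ← sq, ← Complex.cpow_nat_mul]
  have hpi : (Real.pi : ℂ) ≠ 0 := by exact_mod_cast Real.pi_ne_zero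
  rw [← Complex.ofReal_pow, Real.sq_sqrt Real.pi_pos.le]
  norm_num
  field_simp

lemma integral_cexp_neg_mul_norm_sq_complexStdNormalVec (n : ℕ) {z : ℂ} (hz : 0 ≤ z.re) :
    ∫ x, Complex.exp (-z * (‖x‖ ^ 2 : ℝ)) ∂complexStdNormalVec n = ((1 + z) ^ n)⁻¹ := by
  rw [complexStdNormalVec, integral_map (by fun_prop) (by fun_prop)]
  simp only [EuclideanSpace.norm_sq_eq, Complex.ofReal_sum, Finset.mul_sum, Complex.exp_sum,
    Complex.ofReal_pow]
  rw [integral_fintype_prod_eq_prod (fun _ c => Complex.exp (-z * (‖c‖ : ℂ) ^ 2))]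
  simp only [integral_cexp_neg_mul_norm_sq_complexStdNormal hz, Finset.prod_const,
    Finset.card_univ, Fintype.card_fin, inv_pow]

lemma hasGammaLaplace_norm_sq {Ω : Type*} [MeasurableSpace Ω] {P : Measure Ω} {n : ℕ}
    {u : Ω → EuclideanSpace ℂ (Fin n)} (hu : HasLaw u (complexStdNormalVec n) P) :
    HasGammaLaplace P (fun ω => ‖u ω‖ ^ 2) n := fun z hz => by
  rw [← integral_cexp_neg_mul_norm_sq_complexStdNormalVec n hz]
  exact hu.integral_comp (f := fun x => Complex.exp (-z * (‖x‖ ^ 2 : ℝ))) (by fun_prop)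

/-! ### The determinant bound -/

lemma one_add_sum_le_prod_one_add {ι : Type*} (s : Finset ι) (f : ι → ℝ) (hf : ∀ i, 0 ≤ f i) :
    1 + ∑ i ∈ s, f i ≤ ∏ i ∈ s, (1 + f i) := by
  classical
  induction s using Finset.induction_on with
  | empty => simp
  | insert i s hi ih =>
    rw [Finset.sum_insert hi, Finset.prod_insert hi]
    have := Finset.sum_nonneg fun j (_ : j ∈ s) => hf j
    nlinarith [hf i, mul_nonneg (hf i) this]

open scoped ComplexOrder in
/-- In terms of the eigenvalues `λᵢ ≥ 0` of `A`, this is `1 + ∑ λᵢ ≤ ∏ (1 + λᵢ)`. -/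
lemma Matrix.PosSemidef.one_add_trace_re_le_det_one_add_re {n : Type*} [Fintype n] [DecidableEq n]
    {A : Matrix n n ℂ} (hA : A.PosSemidef) : 1 + A.trace.re ≤ (1 + A).det.re := by
  have hd : (1 + A).det = ((∏ i, (1 + hA.1.eigenvalues i) : ℝ) : ℂ) := by
    have h1 := hA.1.charpoly_eq
    have h2 := congrArg (Polynomial.eval (-1)) h1
    rw [Matrix.eval_charpoly, Polynomial.eval_prod] at h2
    have h3 : (Matrix.scalar n) (-1 : ℂ) - A = -(1 + A) := by
      rw [map_neg, map_one]
      abel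
    rw [h3, Matrix.det_neg] at h2
    have h4 (i : n) : Polynomial.eval (-1 : ℂ)
        (Polynomial.X - Polynomial.C (hA.1.eigenvalues i : ℂ)) =
        (-1) * (1 + hA.1.eigenvalues i) := by
      simp
      ring
    simp only [Complex.coe_algebraMap, h4, Finset.prod_mul_distrib, Finset.prod_const,
      Finset.card_univ] at h2
    have := mul_left_cancel₀ (pow_ne_zero _ (by norm_num)) h2
    rw [this]
    push_cast
    rfl
  have ht : A.trace = ((∑ i, hA.1.eigenvalues i : ℝ) : ℂ) := by
    rw [hA.1.trace_eq_sum_eigenvalues]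
    push_cast
    rfl
  rw [hd, ht, Complex.ofReal_re, Complex.ofReal_re]
  exact one_add_sum_le_prod_one_add _ _ hA.eigenvalues_nonneg

lemma chaseGain_nonneg {K NT NR : ℕ} {γ : Fin K → ℝ} (hγ : ∀ k, 0 < γ k)
    (u : Fin K → EuclideanSpace ℂ (Fin NR)) (v : Fin K → EuclideanSpace ℂ (Fin NT)) :
    0 ≤ chaseGain γ u v :=
  Finset.sum_nonneg fun k _ => by
    have := (hγ k).le
    positivity

lemma sum_norm_sq_keyholeMatrix {NT NR : ℕ} (u : EuclideanSpace ℂ (Fin NR))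
    (v : EuclideanSpace ℂ (Fin NT)) :
    ∑ i, ∑ j, ‖keyholeMatrix u v i j‖ ^ 2 = ‖u‖ ^ 2 * ‖v‖ ^ 2 := by
  simp [keyholeMatrix, EuclideanSpace.norm_sq_eq, Finset.sum_mul_sum, mul_pow]

lemma trace_chaseMatrix_mul_conjTranspose {K NT NR : ℕ} {γ : Fin K → ℝ} (hγ : ∀ k, 0 < γ k)
    (u : Fin K → EuclideanSpace ℂ (Fin NR)) (v : Fin K → EuclideanSpace ℂ (Fin NT)) :
    (chaseMatrix γ (fun k => keyholeMatrix (u k) (v k)) *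
      (chaseMatrix γ (fun k => keyholeMatrix (u k) (v k))).conjTranspose).trace.re =
      chaseGain γ u v := by
  simp only [Matrix.trace, Matrix.diag, Matrix.mul_apply, Matrix.conjTranspose_apply,
    Complex.re_sum, chaseGain, Fintype.sum_prod_type]
  refine Finset.sum_congr rfl fun k _ => ?_
  rw [← sum_norm_sq_keyholeMatrix, Finset.mul_sum]
  refine Finset.sum_congr rfl fun i _ => ?_
  rw [Finset.mul_sum]
  refine Finset.sum_congr rfl fun j _ => ?_
  rw [← starRingEnd_apply, Complex.mul_conj, Complex.ofReal_re, ← Complex.sq_norm]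
  have : 0 ≤ γ k / NT := div_nonneg (hγ k).le (Nat.cast_nonneg _)
  rw [chaseMatrix, Matrix.of_apply, norm_mul, mul_pow, Complex.norm_real, Real.norm_eq_abs, sq_abs,
    Real.sq_sqrt this]

open scoped ComplexOrder in
lemma chaseGain_lt_of_mutualInfoCC_lt {K NT NR : ℕ} {γ : Fin K → ℝ} (hγ : ∀ k, 0 < γ k)
    (u : Fin K → EuclideanSpace ℂ (Fin NR)) (v : Fin K → EuclideanSpace ℂ (Fin NT)) {R : ℝ}
    (h : mutualInfoCC γ (fun k => keyholeMatrix (u k) (v k)) < R) :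
    chaseGain γ u v < 2 ^ R - 1 := by
  have h1 := (Matrix.posSemidef_self_mul_conjTranspose
    (chaseMatrix γ (fun k => keyholeMatrix (u k) (v k)))).one_add_trace_re_le_det_one_add_re
  rw [trace_chaseMatrix_mul_conjTranspose hγ] at h1
  have h2 : 0 < 1 + chaseGain γ u v := by linarith [chaseGain_nonneg hγ u v]
  rw [mutualInfoCC, Real.logb_lt_iff_lt_rpow one_lt_two (h2.trans_le h1)] at h
  linarith

/-! ### Inversion of the Laplace transform of a distribution function -/

section Inversion

variable {μ : Measure ℝ} [IsProbabilityMeasure μ]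

lemma integrable_indicator_cexp_neg_mul (hμ : ∀ᵐ t ∂μ, 0 ≤ t) {s : ℂ} (hs : 0 < s.re) :
    Integrable (fun p : ℝ × ℝ =>
      {p : ℝ × ℝ | p.2 ≤ p.1}.indicator (fun p => Complex.exp (-s * p.1)) p) (volume.prod μ) := by
  have hmeas : MeasurableSet {p : ℝ × ℝ | p.2 ≤ p.1} :=
    measurableSet_le measurable_snd measurable_fst
  have hind (t : ℝ) : (fun x : ℝ =>
      {p : ℝ × ℝ | p.2 ≤ p.1}.indicator (fun p => Complex.exp (-s * p.1)) (x, t)) =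
      (Set.Ici t).indicator fun x : ℝ => Complex.exp (-s * x) := by
    funext x
    simp [Set.indicator]
  have hm : Measurable fun p : ℝ × ℝ =>
      {p : ℝ × ℝ | p.2 ≤ p.1}.indicator (fun p => Complex.exp (-s * p.1)) p :=
    Measurable.indicator (by fun_prop) hmeas
  rw [integrable_prod_iff' hm.aestronglyMeasurable]
  refine ⟨Filter.Eventually.of_forall fun t => ?_, ?_⟩
  · rw [hind, integrable_indicator_iff measurableSet_Ici, integrableOn_Ici_iff_integrableOn_Ioi]
    exact integrableOn_exp_mul_complex_Ioi (by simpa using hs) t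
  · refine Integrable.mono' (integrable_const (1 / s.re))
      (hm.norm.stronglyMeasurable.integral_prod_left').aestronglyMeasurable ?_
    filter_upwards [hμ] with t ht
    have e : (fun x : ℝ =>
        ‖{p : ℝ × ℝ | p.2 ≤ p.1}.indicator (fun p => Complex.exp (-s * p.1)) (x, t)‖) =
        (Set.Ici t).indicator fun x : ℝ => Real.exp (-s.re * x) := by
      funext x
      by_cases h : t ≤ x <;> simp [Set.indicator, h, Complex.norm_exp]
    rw [e, integral_indicator measurableSet_Ici, integral_Ici_eq_integral_Ioi,
      integral_exp_mul_Ioi (by simpa using hs), neg_div_neg_eq, Real.norm_of_nonneg (by positivity)]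
    gcongr
    rw [Real.exp_le_one_iff]
    nlinarith

lemma integral_indicator_cexp_eq_cdf (s : ℂ) (x : ℝ) :
    ∫ t, {p : ℝ × ℝ | p.2 ≤ p.1}.indicator (fun p => Complex.exp (-s * p.1)) (x, t) ∂μ =
      Complex.exp (-s * x) * (cdf μ x : ℝ) := by
  have e : (fun t : ℝ =>
      {p : ℝ × ℝ | p.2 ≤ p.1}.indicator (fun p => Complex.exp (-s * p.1)) (x, t)) =
      (Set.Iic x).indicator fun _ => Complex.exp (-s * x) := by
    funext t
    simp [Set.indicator]
  rw [e, integral_indicator measurableSet_Iic, setIntegral_const, cdf_eq_real, Complex.real_smul,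
    mul_comm]

lemma integrable_cexp_neg_mul_cdf (hμ : ∀ᵐ t ∂μ, 0 ≤ t) {s : ℂ} (hs : 0 < s.re) :
    Integrable fun x : ℝ => Complex.exp (-s * x) * (cdf μ x : ℝ) := by
  simpa only [integral_indicator_cexp_eq_cdf] using
    (integrable_indicator_cexp_neg_mul hμ hs).integral_prod_left

lemma integral_cexp_neg_mul_cdf (hμ : ∀ᵐ t ∂μ, 0 ≤ t) {s : ℂ} (hs : 0 < s.re) :
    ∫ x : ℝ, Complex.exp (-s * x) * (cdf μ x : ℝ) = (∫ t, Complex.exp (-s * t) ∂μ) / s := by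
  have h := integral_integral_swap (f := fun x t : ℝ =>
    {p : ℝ × ℝ | p.2 ≤ p.1}.indicator (fun p => Complex.exp (-s * p.1)) (x, t))
    (integrable_indicator_cexp_neg_mul hμ hs)
  simp only [integral_indicator_cexp_eq_cdf] at h
  rw [h, ← integral_div]
  congr 1
  funext t
  have e : (fun x : ℝ =>
      {p : ℝ × ℝ | p.2 ≤ p.1}.indicator (fun p => Complex.exp (-s * p.1)) (x, t)) =
      (Set.Ici t).indicator fun x : ℝ => Complex.exp (-s * x) := by
    funext x
    simp [Set.indicator]
  rw [e, integral_indicator measurableSet_Ici, integral_Ici_eq_integral_Ioi,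
    integral_exp_mul_complex_Ioi (by simpa using hs), neg_div_neg_eq]

/-- Bromwich inversion for a distribution function. Fourier inversion applies at the continuity
points, which are dense, and both sides are right-continuous. -/
theorem cdf_eq_bromwich (hμ : ∀ᵐ t ∂μ, 0 ≤ t) {a : ℝ} (ha : 0 < a)
    (hint : Integrable fun y : ℝ =>
      (∫ t, Complex.exp (-(a + y * Complex.I) * t) ∂μ) / (a + y * Complex.I)) (x : ℝ) :
    ((cdf μ x : ℝ) : ℂ) = 1 / (2 * Real.pi) * ∫ y : ℝ,
      (∫ t, Complex.exp (-(a + y * Complex.I) * t) ∂μ) / (a + y * Complex.I) *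
        Complex.exp ((a + y * Complex.I) * x) := by
  set L : ℝ → ℂ := fun y =>
    (∫ t, Complex.exp (-(a + y * Complex.I) * t) ∂μ) / (a + y * Complex.I) with hL
  have hre (y : ℝ) : 0 < ((a : ℂ) + y * Complex.I).re := by simpa using ha
  set g : ℝ → ℂ := fun x => Complex.exp (-(a : ℂ) * x) * (cdf μ x : ℝ) with hg
  have hgi : Integrable g := integrable_cexp_neg_mul_cdf hμ (by simpa using ha)
  have hF : FourierTransform.fourier g = fun w => L (2 * Real.pi * w) := by
    funext w
    rw [Real.fourier_real_eq_integral_exp_smul]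
    simp only [hL]
    rw [← integral_cexp_neg_mul_cdf hμ (hre _)]
    congr 1
    funext v
    rw [hg, smul_eq_mul, ← mul_assoc, ← Complex.exp_add]
    congr 2
    push_cast
    ring
  have hpi : 2 * Real.pi ≠ 0 := by positivity
  have hFi : Integrable (FourierTransform.fourier g) := by
    rw [hF]
    exact hint.comp_mul_left' hpi
  set B : ℝ → ℂ := fun x => ∫ y : ℝ, L y * Complex.exp ((a + y * Complex.I) * x) with hB
  have hnorm (x y : ℝ) : ‖Complex.exp ((a + y * Complex.I) * x)‖ = Real.exp (a * x) := by
    simp [Complex.norm_exp]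
  have hBcont : Continuous B := by
    rw [continuous_iff_continuousAt]
    intro x₀
    refine continuousAt_of_dominated (bound := fun y => ‖L y‖ * Real.exp (a * (x₀ + 1)))
      (Filter.Eventually.of_forall fun x =>
        hint.aestronglyMeasurable.mul (by fun_prop)) ?_ (hint.norm.mul_const _)
      (Filter.Eventually.of_forall fun y => by fun_prop)
    filter_upwards [Iio_mem_nhds (show x₀ < x₀ + 1 by linarith)] with x hx
    refine Filter.Eventually.of_forall fun y => ?_
    rw [norm_mul, hnorm]
    have : x ≤ x₀ + 1 := le_of_lt hx
    gcongr
  have hcontAt (x : ℝ) (hx : ContinuousAt (cdf μ) x) :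
      ((cdf μ x : ℝ) : ℂ) = 1 / (2 * Real.pi) * B x := by
    have hgx : ContinuousAt g x :=
      ContinuousAt.mul (by fun_prop) (Complex.continuous_ofReal.continuousAt.comp hx)
    have h1 := hgi.fourierInv_fourier_eq hFi hgx
    rw [Real.fourierInv_eq', hF] at h1
    have h2 := Measure.integral_comp_mul_left
      (fun y : ℝ => Complex.exp (y * x * Complex.I) * L y) (2 * Real.pi)
    have h3 : (fun w : ℝ => Complex.exp ((2 * Real.pi * inner ℝ w x : ℝ) * Complex.I) •
        L (2 * Real.pi * w)) =
        fun w : ℝ => Complex.exp ((2 * Real.pi * w : ℝ) * x * Complex.I) *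
          L (2 * Real.pi * w) := by
      funext w
      simp
      ring_nf
      simp
    rw [h3, h2, abs_of_pos (by positivity), Complex.real_smul] at h1
    have h4 : B x = Complex.exp (a * x) *
        ∫ y : ℝ, Complex.exp (y * x * Complex.I) * L y := by
      rw [← integral_const_mul]
      simp only [hB]
      congr 1
      funext y
      rw [show ((a : ℂ) + y * Complex.I) * x = a * x + y * x * Complex.I by ring, Complex.exp_add]
      ring
    rw [h4, mul_left_comm]
    push_cast at h1
    rw [one_div, h1, hg, ← mul_assoc, ← Complex.exp_add]
    simp
  have hdense : Dense {x : ℝ | ContinuousAt (cdf μ) x} := by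
    have := (monotone_cdf μ).countable_not_continuousAt.dense_compl ℝ
    convert! this using 1
    ext z
    simp
  have hcl : x ∈ closure (Set.Ioi x ∩ {x : ℝ | ContinuousAt (cdf μ) x}) := by
    refine closure_minimal (hdense.open_subset_closure_inter isOpen_Ioi) isClosed_closure ?_
    rw [closure_Ioi]
    exact Set.self_mem_Ici
  have := mem_closure_iff_nhdsWithin_neBot.mp hcl
  have hl : Filter.Tendsto (fun x => ((cdf μ x : ℝ) : ℂ))
      (nhdsWithin x (Set.Ioi x ∩ {x : ℝ | ContinuousAt (cdf μ) x}))
      (nhds ((cdf μ x : ℝ) : ℂ)) :=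
    (Complex.continuous_ofReal.tendsto _).comp (((cdf μ).right_continuous x).mono_left
      (nhdsWithin_mono _ fun z hz => Set.mem_Ici.mpr (le_of_lt hz.1)))
  have hr : Filter.Tendsto (fun x => 1 / (2 * Real.pi) * B x)
      (nhdsWithin x (Set.Ioi x ∩ {x : ℝ | ContinuousAt (cdf μ) x}))
      (nhds (1 / (2 * Real.pi) * B x)) :=
    ((continuous_const.mul hBcont).tendsto x).mono_left nhdsWithin_le_nhds
  refine tendsto_nhds_unique hl (hr.congr' ?_)
  filter_upwards [self_mem_nhdsWithin] with z hz
  exact (hcontAt z hz.2).symm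

/-- Decay `O(‖s‖^{-1/2})` of the Laplace transform gives an integrand `O(‖s‖^{-3/2})` on the
vertical line. -/
lemma integrable_laplace_div {a : ℝ} (ha : 0 < a) {C : ℝ}
    (hC : ∀ y : ℝ, ‖∫ t, Complex.exp (-(a + y * Complex.I) * t) ∂μ‖ ≤
      C * (√‖(a + y * Complex.I : ℂ)‖)⁻¹) :
    Integrable fun y : ℝ =>
      (∫ t, Complex.exp (-(a + y * Complex.I) * t) ∂μ) / (a + y * Complex.I) := by
  have hmeas : AEStronglyMeasurable (fun y : ℝ =>
      (∫ t, Complex.exp (-(a + y * Complex.I) * t) ∂μ) / (a + y * Complex.I)) volume := by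
    have h1 : StronglyMeasurable fun y : ℝ => ∫ t, Complex.exp (-(a + y * Complex.I) * t) ∂μ := by
      refine StronglyMeasurable.integral_prod_right
        (f := fun y t : ℝ => Complex.exp (-(a + y * Complex.I) * t)) ?_
      exact Continuous.stronglyMeasurable (by fun_prop)
    have h2 : Measurable fun y : ℝ => (a + y * Complex.I : ℂ) := by fun_prop
    exact (h1.measurable.div h2).aestronglyMeasurable
  set c : ℝ := min (a ^ 2) 1 with hc
  have hc0 : 0 < c := lt_min (by positivity) one_pos
  have hI := (integrable_rpow_neg_one_add_norm_sq (E := ℝ) (μ := volume) (r := 3 / 2)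
    (by simp; norm_num)).const_mul (|C| * c ^ (-(3 / 2) / 2 : ℝ))
  refine hI.mono' hmeas (Filter.Eventually.of_forall fun y => ?_)
  set s : ℂ := a + y * Complex.I with hs
  have hsq : ‖s‖ ^ 2 = a ^ 2 + y ^ 2 := by
    rw [Complex.sq_norm, hs, Complex.normSq_add_mul_I]
  have hpos : 0 < ‖s‖ := by
    have : 0 < ‖s‖ ^ 2 := by rw [hsq]; positivity
    exact (sq_pos_iff.mp this).lt_of_le' (norm_nonneg _)
  have hge : c * (1 + ‖y‖ ^ 2) ≤ ‖s‖ ^ 2 := by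
    rw [hsq, Real.norm_eq_abs, sq_abs, mul_add, mul_one]
    have h1 : c ≤ a ^ 2 := min_le_left _ _
    have h2 : c ≤ 1 := min_le_right _ _
    nlinarith [sq_nonneg y]
  have hpow : (√‖s‖)⁻¹ * ‖s‖⁻¹ = (‖s‖ ^ 2) ^ (-(3 / 2) / 2 : ℝ) := by
    rw [← Real.rpow_natCast, ← Real.rpow_mul hpos.le, Real.sqrt_eq_rpow, ← Real.rpow_neg hpos.le,
      ← Real.rpow_neg_one ‖s‖, ← Real.rpow_add hpos]
    norm_num
  rw [norm_div, div_eq_mul_inv]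
  calc _ ≤ |C| * (√‖s‖)⁻¹ * ‖s‖⁻¹ := by
        gcongr
        exact (hC y).trans (by gcongr; exact le_abs_self C)
    _ = |C| * (‖s‖ ^ 2) ^ (-(3 / 2) / 2 : ℝ) := by rw [mul_assoc, hpow]
    _ ≤ |C| * (c * (1 + ‖y‖ ^ 2)) ^ (-(3 / 2) / 2 : ℝ) := by
        gcongr ?_ * ?_
        exact Real.rpow_le_rpow_of_nonpos (by positivity) hge (by norm_num)
    _ = _ := by
        rw [Real.mul_rpow hc0.le (by positivity), mul_assoc]

end Inversion

/-! ### The distribution of the chase-combining gain -/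

section ChaseCombining

variable {Ω : Type*} [MeasurableSpace Ω] {P : Measure Ω} {K : ℕ}
  {U V : Fin K → Ω → ℝ} {c : Fin K → ℝ} {m n : ℕ}

/-- Independence of the products is used instead of joint independence of all factors. -/
lemma integral_cexp_neg_mul_sum (hU : ∀ k, AEMeasurable (U k) P)
    (hV : ∀ k, AEMeasurable (V k) P) (hUV : iIndepFun (fun k ω => U k ω * V k ω) P) (s : ℂ) :
    ∫ ω, Complex.exp (-s * ((∑ k, c k * (U k ω * V k ω) : ℝ) : ℂ)) ∂P =
      ∏ k, ∫ ω, Complex.exp (-(s * c k) * (U k ω * V k ω)) ∂P := by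
  rw [← iIndepFun.integral_fun_prod_eq_prod_integral]
  · congr 1
    funext ω
    rw [← Complex.exp_sum]
    push_cast
    rw [Finset.mul_sum]
    congr 1
    refine Finset.sum_congr rfl fun k _ => ?_
    ring
  · have := hUV.comp (fun k (t : ℝ) => Complex.exp (-(s * c k) * t)) (fun k => by fun_prop)
    simpa [Function.comp_def] using this
  · intro k
    have h1 := hU k
    have h2 := hV k
    exact AEMeasurable.aestronglyMeasurable (by fun_prop)

variable [IsProbabilityMeasure P]

/-- The Bromwich representation of the distribution function of `∑ₖ (γₖ / N_T) Uₖ Vₖ`, where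
`Uₖ` and `Vₖ` are independent with Gamma laws of shapes `m` and `n`. The Tricomi function comes
with the shape of `Uₖ` as its first parameter, so that the two cases of the theorem differ only in
which of the two squared norms is called `Uₖ`. -/
theorem verticalIntegrable_and_cdf_eq_bromwichCDF {NT NR : ℕ} {γ : Fin K → ℝ} (hK : 1 ≤ K)
    (hNT : 1 ≤ NT) (hγ : ∀ k, 0 < γ k) (hm : 1 ≤ m) (hn : 1 ≤ n)
    (hτ : |(NT : ℝ) - NR| = m - n)
    (hU : ∀ k, AEMeasurable (U k) P) (hV : ∀ k, AEMeasurable (V k) P)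
    (hU0 : ∀ k ω, 0 ≤ U k ω) (hV0 : ∀ k ω, 0 ≤ V k ω) (hind : ∀ k, IndepFun (U k) (V k) P)
    (hUL : ∀ k, HasGammaLaplace P (U k) m) (hVL : ∀ k, HasGammaLaplace P (V k) n)
    (hUV : iIndepFun (fun k ω => U k ω * V k ω) P) {a : ℝ} (ha : 0 < a) (x : ℝ) :
    Complex.VerticalIntegrable (bromwichIntegrand NT NR m γ x) a ∧
      ((cdf (P.map fun ω => ∑ k, γ k / NT * (U k ω * V k ω)) x : ℝ) : ℂ) =
        bromwichCDF NT NR m γ a x := by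
  obtain ⟨b, rfl⟩ := Nat.exists_eq_add_of_le' hm
  obtain ⟨d, rfl⟩ := Nat.exists_eq_add_of_le' hn
  have hNT0 : (0 : ℝ) < NT := by exact_mod_cast hNT
  have hc (k : Fin K) : 0 < γ k / NT := div_pos (hγ k) hNT0
  set X : Ω → ℝ := fun ω => ∑ k, γ k / NT * (U k ω * V k ω) with hX
  have hXm : AEMeasurable X P := by fun_prop
  have := Measure.isProbabilityMeasure_map (μ := P) hXm
  have hpos : ∀ᵐ t ∂P.map X, 0 ≤ t :=
    (ae_map_iff hXm measurableSet_Ici).mpr (Filter.Eventually.of_forall fun ω =>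
      Finset.sum_nonneg fun k _ => mul_nonneg (hc k).le (mul_nonneg (hU0 k ω) (hV0 k ω)))
  have hre {s : ℂ} (hs : 0 < s.re) (k : Fin K) : 0 < (s * (γ k / NT : ℝ)).re := by
    rw [Complex.re_mul_ofReal]
    exact mul_pos hs (hc k)
  have hprod (s : ℂ) : ∫ t, Complex.exp (-s * t) ∂P.map X =
      ∏ k, ∫ ω, Complex.exp (-(s * (γ k / NT : ℝ)) * (U k ω * V k ω)) ∂P := by
    rw [integral_map hXm (by fun_prop)]
    exact integral_cexp_neg_mul_sum hU hV hUV s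
  have hlaplace {s : ℂ} (hs : 0 < s.re) : ∫ t, Complex.exp (-s * t) ∂P.map X =
      (∏ k, (((NT / γ k) ^ (b + 1) : ℝ) : ℂ)) *
        ((∏ k, tricomiPsi ((b + 1 : ℕ) : ℂ) (((|(NT : ℝ) - (NR : ℝ)| + 1 : ℝ) : ℂ))
          (((NT / γ k : ℝ) : ℂ) * s⁻¹)) / s ^ (K * (b + 1))) := by
    have hpow : s ^ (K * (b + 1)) = ∏ _k : Fin K, s ^ (b + 1) := by
      rw [Finset.prod_const, Finset.card_univ, Fintype.card_fin, ← pow_mul, mul_comm]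
    rw [hprod, hpow, ← Finset.prod_div_distrib, ← Finset.prod_mul_distrib]
    refine Finset.prod_congr rfl fun k _ => ?_
    rw [integral_cexp_neg_mul_mul (hU k) (hV k) (hU0 k) (hV0 k) (hind k) (hUL k) (hVL k) (hre hs k),
      integral_gamma_inv_pow_eq_tricomiPsi d b (hre hs k), hτ]
    have h1 : (s * ((γ k / NT : ℝ) : ℂ))⁻¹ = ((NT / γ k : ℝ) : ℂ) * s⁻¹ := by
      rw [mul_inv, ← Complex.ofReal_inv, inv_div, mul_comm]
    rw [← inv_pow, h1, mul_pow]
    push_cast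
    ring
  have hbound : ∃ C : ℝ, ∀ s : ℂ, 0 < s.re →
      ‖∫ t, Complex.exp (-s * t) ∂P.map X‖ ≤ C * (√‖s‖)⁻¹ := by
    -- One factor supplies the decay; the others are at most `1` in norm.
    obtain ⟨C, hC⟩ := exists_norm_integral_cexp_neg_mul_mul_le (hU ⟨0, hK⟩) (hV ⟨0, hK⟩)
      (hU0 _) (hV0 _) (hind _) (hUL _) (hVL _)
    refine ⟨C * (√(γ ⟨0, hK⟩ / NT))⁻¹, fun s hs => ?_⟩
    rw [hprod, norm_prod, ← Finset.mul_prod_erase _ _ (Finset.mem_univ ⟨0, hK⟩)]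
    have h1 : ∏ k ∈ Finset.univ.erase ⟨0, hK⟩,
        ‖∫ ω, Complex.exp (-(s * (γ k / NT : ℝ)) * (U k ω * V k ω)) ∂P‖ ≤ 1 := by
      refine Finset.prod_le_one (fun _ _ => norm_nonneg _) fun k _ => ?_
      refine (norm_integral_le_of_norm_le (integrable_const (1 : ℝ))
        (Filter.Eventually.of_forall fun ω => ?_)).trans (by simp)
      rw [Complex.norm_exp, Real.exp_le_one_iff, neg_mul, Complex.neg_re, ← Complex.ofReal_mul,
        Complex.re_mul_ofReal]
      exact neg_nonpos.mpr (mul_nonneg (hre hs k).le (mul_nonneg (hU0 k ω) (hV0 k ω)))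
    refine (mul_le_of_le_one_right (norm_nonneg _) h1).trans ((hC _ (hre hs _)).trans_eq ?_)
    rw [norm_mul, Complex.norm_real, Real.norm_of_nonneg (hc _).le,
      Real.sqrt_mul (norm_nonneg _), mul_inv]
    ring
  obtain ⟨C, hC⟩ := hbound
  have hline (y : ℝ) : 0 < ((a : ℂ) + y * Complex.I).re := by simpa using ha
  have hint := integrable_laplace_div ha fun y => hC _ (hline y)
  have hcdf := cdf_eq_bromwich hpos ha hint x
  set A : ℂ := ∏ k, (((NT / γ k) ^ (b + 1) : ℝ) : ℂ) with hA
  have hA0 : A ≠ 0 := Finset.prod_ne_zero_iff.mpr fun k _ =>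
    Complex.ofReal_ne_zero.mpr (pow_ne_zero _ (div_pos hNT0 (hγ k)).ne')
  have hintegrand (y : ℝ) :
      (∫ t, Complex.exp (-(a + y * Complex.I) * t) ∂P.map X) / (a + y * Complex.I) *
        Complex.exp ((a + y * Complex.I) * x) =
      A * bromwichIntegrand NT NR (b + 1) γ x (a + y * Complex.I) := by
    rw [hlaplace (hline y), bromwichIntegrand, pow_succ _ (K * (b + 1)), div_mul_eq_div_div]
    ring
  constructor
  · have h1 := (hint.mul_bdd (c := Real.exp (a * x))
      (g := fun y : ℝ => Complex.exp ((a + y * Complex.I) * x)) (by fun_prop)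
      (Filter.Eventually.of_forall fun y => by simp [Complex.norm_exp])).const_mul A⁻¹
    refine h1.congr (Filter.Eventually.of_forall fun y => ?_)
    simp only [hintegrand, inv_mul_cancel_left₀ hA0]
  · rw [hcdf]
    simp only [hintegrand]
    rw [integral_const_mul, bromwichCDF, verticalLineIntegral, integral_mul_const]
    have hpi : (Real.pi : ℂ) ≠ 0 := Complex.ofReal_ne_zero.mpr Real.pi_ne_zero
    rw [← hA]
    generalize (∫ y : ℝ, bromwichIntegrand NT NR (b + 1) γ x (a + y * Complex.I)) = J
    field_simp

end ChaseCombining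

/-! ### The Bromwich formula and the outage bound -/

theorem theorem2 {Ω : Type*} [MeasurableSpace Ω] (P : Measure Ω) [IsProbabilityMeasure P]
    (K NT NR : ℕ) (hK : 1 ≤ K) (hNT : 1 ≤ NT) (hNR : 1 ≤ NR)
    (γ : Fin K → ℝ) (hγ : ∀ k, 0 < γ k)
    (u : Fin K → Ω → EuclideanSpace ℂ (Fin NR))
    (v : Fin K → Ω → EuclideanSpace ℂ (Fin NT))
    (hu : ∀ k, HasLaw (u k) (complexStdNormalVec NR) P)
    (hv : ∀ k, HasLaw (v k) (complexStdNormalVec NT) P)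
    (huv : ∀ k, IndepFun (u k) (v k) P)
    (hH : iIndepFun (β := fun _ => Fin NR → Fin NT → ℂ)
      (fun k ω i j => keyholeMatrix (u k ω) (v k ω) i j) P) :
    -- the CDF of `X_CC` as an absolutely convergent Bromwich integral
    (∀ a : ℝ, 0 < a → ∀ x : ℝ,
      (NR ≤ NT →
        Complex.VerticalIntegrable (bromwichIntegrand NT NR NT γ x) a ∧
        ((cdf (P.map fun ω => chaseGain γ (fun k => u k ω) (fun k => v k ω)) x : ℝ) : ℂ) =
          bromwichCDF NT NR NT γ a x) ∧
      (NT < NR →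
        Complex.VerticalIntegrable (bromwichIntegrand NT NR NR γ x) a ∧
        ((cdf (P.map fun ω => chaseGain γ (fun k => u k ω) (fun k => v k ω)) x : ℝ) : ℂ) =
          bromwichCDF NT NR NR γ a x)) ∧
    -- the upper bound of the outage probability, at `x = 2 ^ R - 1`
    (∀ R : ℝ,
      P.real {ω | mutualInfoCC γ (fun k => keyholeMatrix (u k ω) (v k ω)) < R} ≤
        cdf (P.map fun ω => chaseGain γ (fun k => u k ω) (fun k => v k ω)) ((2 : ℝ) ^ R - 1) ∧
      ∀ a : ℝ, 0 < a →
        (NR ≤ NT →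
          P.real {ω | mutualInfoCC γ (fun k => keyholeMatrix (u k ω) (v k ω)) < R} ≤
            (bromwichCDF NT NR NT γ a ((2 : ℝ) ^ R - 1)).re) ∧
        (NT < NR →
          P.real {ω | mutualInfoCC γ (fun k => keyholeMatrix (u k ω) (v k ω)) < R} ≤
            (bromwichCDF NT NR NR γ a ((2 : ℝ) ^ R - 1)).re)) := by
  have hum k : AEMeasurable (u k) P := (hu k).aemeasurable
  have hvm k : AEMeasurable (v k) P := (hv k).aemeasurable
  have hsq (d : ℕ) : Measurable fun z : EuclideanSpace ℂ (Fin d) => ‖z‖ ^ 2 := by fun_prop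
  have hUm k : AEMeasurable (fun ω => ‖u k ω‖ ^ 2) P := (hsq _).comp_aemeasurable (hum k)
  have hVm k : AEMeasurable (fun ω => ‖v k ω‖ ^ 2) P := (hsq _).comp_aemeasurable (hvm k)
  have hind k : IndepFun (fun ω => ‖u k ω‖ ^ 2) (fun ω => ‖v k ω‖ ^ 2) P :=
    (huv k).comp (hsq _) (hsq _)
  -- `‖uₖ‖² ‖vₖ‖²` is the squared Frobenius norm of `Hₖ`, so independence passes to it.
  have hUV : iIndepFun (fun k ω => ‖u k ω‖ ^ 2 * ‖v k ω‖ ^ 2) P := by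
    have := hH.comp (fun _ (M : Fin NR → Fin NT → ℂ) => ∑ i, ∑ j, ‖M i j‖ ^ 2)
      (fun _ => by fun_prop)
    simpa only [Function.comp_def, sum_norm_sq_keyholeMatrix] using this
  have hXm : AEMeasurable (fun ω => chaseGain γ (fun k => u k ω) (fun k => v k ω)) P := by
    unfold chaseGain
    fun_prop
  have hcdf : ∀ a : ℝ, 0 < a → ∀ x : ℝ,
      (NR ≤ NT →
        Complex.VerticalIntegrable (bromwichIntegrand NT NR NT γ x) a ∧
        ((cdf (P.map fun ω => chaseGain γ (fun k => u k ω) (fun k => v k ω)) x : ℝ) : ℂ) =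
          bromwichCDF NT NR NT γ a x) ∧
      (NT < NR →
        Complex.VerticalIntegrable (bromwichIntegrand NT NR NR γ x) a ∧
        ((cdf (P.map fun ω => chaseGain γ (fun k => u k ω) (fun k => v k ω)) x : ℝ) : ℂ) =
          bromwichCDF NT NR NR γ a x) := by
    intro a ha x
    constructor
    · intro h
      have hτ : |(NT : ℝ) - NR| = NT - NR :=
        abs_of_nonneg (sub_nonneg.mpr (by exact_mod_cast h))
      have := verticalIntegrable_and_cdf_eq_bromwichCDF hK hNT hγ hNT hNR hτ hVm hUm
        (fun _ _ => by positivity) (fun _ _ => by positivity) (fun k => (hind k).symm)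
        (fun k => hasGammaLaplace_norm_sq (hv k)) (fun k => hasGammaLaplace_norm_sq (hu k))
        (by simpa only [mul_comm] using hUV) ha x
      simpa only [chaseGain, mul_comm (‖u _ _‖ ^ 2)] using this
    · intro h
      have hτ : |(NT : ℝ) - NR| = NR - NT := by
        rw [abs_sub_comm]
        exact abs_of_nonneg (sub_nonneg.mpr (by exact_mod_cast h.le))
      exact verticalIntegrable_and_cdf_eq_bromwichCDF hK hNT hγ hNR hNT hτ hUm hVm
        (fun _ _ => by positivity) (fun _ _ => by positivity) hind
        (fun k => hasGammaLaplace_norm_sq (hu k)) (fun k => hasGammaLaplace_norm_sq (hv k))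
        hUV ha x
  refine ⟨hcdf, fun R => ?_⟩
  have hout : P.real {ω | mutualInfoCC γ (fun k => keyholeMatrix (u k ω) (v k ω)) < R} ≤
      cdf (P.map fun ω => chaseGain γ (fun k => u k ω) (fun k => v k ω)) ((2 : ℝ) ^ R - 1) := by
    have := Measure.isProbabilityMeasure_map (μ := P) hXm
    rw [cdf_eq_real, map_measureReal_apply_of_aemeasurable hXm measurableSet_Iic]
    exact measureReal_mono fun ω hω => (chaseGain_lt_of_mutualInfoCC_lt hγ _ _ hω).le
  refine ⟨hout, fun a ha => ⟨fun h => ?_, fun h => ?_⟩⟩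
  · rw [← ((hcdf a ha _).1 h).2, Complex.ofReal_re]
    exact hout
  · rw [← ((hcdf a ha _).2 h).2, Complex.ofReal_re]
    exact hout
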